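/- All rings are commutative, unitary and nonzero. For a ring $R$, $n\ge 1$ and $(a_1,\dots,a_n)\in R^n$ put $$M_n(a_1,\dots,a_n)=\begin{pmatrix} a_n & -1\\ 1 & 0\end{pmatrix}\cdots\begin{pmatrix} a_1 & -1\\ 1 & 0\end{pmatrix}.$$ The tuple is a $\lambda$-quiddity over $R$ (of size $n$) if $M_n(a_1,\dots,a_n)=\pm\mathrm{Id}$. For $n,m\ge 2$ put $(a_1,\dots,a_n)\oplus(b_1,\dots,b_m)=(a_1+b_m,a_2,\dots,a_{n-1},a_n+b_1,b_2,\dots,b_{m-1})$, and write $(a_1,\dots,a_n)\sim(b_1,\dots,b_n)$ if the second tuple is a cyclic rotation of $(a_1,\dots,a_n)$ or of $(a_n,\dots,a_1)$. A $\lambda$-quiddity $(c_1,\dots,c_n)$ with $n\ge 3$ is reducible if $(c_1,\dots,c_n)\sim(a_1,\dots,a_m)\oplus(b_1,\dots,b_l)$ for some $m,l\ge 3$, some $\lambda$-quiddity $(b_1,\dots,b_l)$ over $R$ and some $(a_1,\dots,a_m)\in R^m$. Let $\mathrm{Irr}(R)$ be the set of the $\lambda$-quiddities over $R$ of size at least $3$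 that are not reducible, and let $\ell_R\in\mathbb N\cup\{+\infty\}$ be the maximal size of an element of $\mathrm{Irr}(R)$, with $\ell_R=+\infty$ if these sizes are unbounded. **Theorem.** Let $A$ be a finite commutative unitary ring, $A\neq\{0\}$. Then $$\ell_{A[X]}<+\infty\iff A\cong\mathbb Z/2\mathbb Z\ \text{ or }\ A\cong\mathbb Z/3\mathbb Z .$$ Moreover, for $k\in\{2,3\}$, $\ell_{(\mathbb Z/k\mathbb Z)[X]}=4$ and $$\mathrm{Irr}((\mathbb Z/k\mathbb Z)[X])=\{\pm(1,1,1)\}\cup\{(0,P,0,-P),\,(P,0,-P,0) : P\in(\mathbb Z/k\mathbb Z)[X]\setminus\{1,-1\}\}.$$ -/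

import Mathlib

namespace LambdaQuiddity

/-- The elementary matrix with rows `(a, -1)` and `(1, 0)`. -/
def elemMat {R : Type*} [CommRing R] (a : R) : Matrix (Fin 2) (Fin 2) R :=
  !![a, -1; 1, 0]

/-- A tuple `(a₁, …, aₙ)` is encoded as the list `[a₁, …, aₙ]`, and `M [a₁, …, aₙ]` is the product
`elemMat aₙ * ⋯ * elemMat a₁` (the last entry is the leftmost factor). -/
def M {R : Type*} [CommRing R] (a : List R) : Matrix (Fin 2) (Fin 2) R :=
  (a.map elemMat).reverse.prod

/-- `(a₁, …, aₙ)`, `n ≥ 1`, is a `λ`-quiddity if `Mₙ(a₁, …, aₙ) = ± Id`. -/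
def IsQuiddity {R : Type*} [CommRing R] (a : List R) : Prop :=
  1 ≤ a.length ∧ (M a = 1 ∨ M a = -1)

/-- The sum
`(a₁, …, aₙ) ⊕ (b₁, …, bₘ) = (a₁ + bₘ, a₂, …, aₙ₋₁, aₙ + b₁, b₂, …, bₘ₋₁)`.
It is meaningful for `n, m ≥ 2`; it is only used for `n, m ≥ 3`. -/
def oplus {R : Type*} [CommRing R] (a b : List R) : List R :=
  (a.headD 0 + b.getLastD 0) ::
    (a.tail.dropLast ++ (a.getLastD 0 + b.headD 0) :: b.tail.dropLast)

theorem oplus_eq {R : Type*} [CommRing R] (x x' y y' : R) (s t : List R) :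
    oplus (x :: (s ++ [x'])) (y :: (t ++ [y'])) = (x + y') :: (s ++ (x' + y) :: t) := by
  simp only [oplus, ← List.cons_append, List.getLastD_concat]
  simp

/-- Two tuples are equivalent if the second is a cyclic rotation of the first or of the
reversed first. -/
def Equivalent {R : Type*} (a b : List R) : Prop :=
  a.IsRotated b ∨ a.reverse.IsRotated b

/-- Reducibility of a tuple (applied below to `λ`-quiddities of size at least 3). -/
def IsReducible {R : Type*} [CommRing R] (c : List R) : Prop :=
  ∃ a b : List R, IsQuiddity b ∧ 3 ≤ a.length ∧ 3 ≤ b.length ∧ Equivalent c (oplus a b)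

/-- The set of irreducible `λ`-quiddities over `R`. Over a nonzero ring the only `λ`-quiddity of
size less than 3 is `(0, 0)`, which by convention is not irreducible. -/
def Irr (R : Type*) [CommRing R] : Set (List R) :=
  {c | IsQuiddity c ∧ 3 ≤ c.length ∧ ¬ IsReducible c}

/-- The maximal size of the irreducible `λ`-quiddities over `R`, equal to `⊤` exactly when their
sizes are unbounded. -/
noncomputable def ell (R : Type*) [CommRing R] : ℕ∞ :=
  ⨆ c ∈ Irr R, (c.length : ℕ∞)

end LambdaQuiddity

/-!
The `(0, 0)` entry of `M t` is the continuant of the tuple `t`. A tuple `t` can be completed by one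
entry on each side to a `λ`-quiddity exactly when its continuant is `±1`, so a `λ`-quiddity of size
`n` is reducible exactly when some block of at most `n - 3` cyclically consecutive entries has
continuant `±1` (`isReducible_iff`).

If `A` is a domain whose only elements are `0` and `±1`, an irreducible `λ`-quiddity of size at
least `4` over `A[X]` has no entry `±1`. The degrees of the continuants of nonconstant polynomials
increase with the size, and the continuant of `(c₁, …, cₙ₋₁)` vanishes, so some entry is constant,
hence `0`. Since `(0, y)` has continuant `-1`, the size is `4`, and the `λ`-quiddities of size `4`
with a zero entry are known explicitly (`Irr_polynomial_eq`).

For the other finite rings, a tuple `c` is encoded by the sequence of vectors `vᵢ` of `R²` with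
`vᵢ₊₁ = cᵢ vᵢ - vᵢ₋₁`. Consecutive vectors have determinant `1`, and the continuant of a block is
the determinant of the two vectors that flank it. So irreducible `λ`-quiddities come from chordless
cycles of the Farey graph of `R`, in which vectors are joined when their determinant is `±1`
(`exists_mem_Irr_of_cycle`), and it suffices to find long chordless cycles over `A[X]`. Both
constructions start from the path of vectors `(Dᵢ₊₁, Dᵢ)`, where `D₀ = 0`, `D₁ = 1` and
`Dᵢ₊₂ = X ^ d Dᵢ₊₁ - Dᵢ`, so that `Dᵢ` is monic of degree `d (i - 1)` for `i ≥ 1`; the determinant of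
two vectors `k` steps apart is `D_k`.

* If `A[X]` has a unit `b ≠ ±1`, the cycle runs along the path and returns along the same vectors,
  scaled alternately by `b` and `-b⁻¹`, up to a modification at its two ends. Parallel vectors have
  determinant `0`, neighbouring ones on different runs have determinant `±b` or `±b⁻¹`, and in the
  determinants of the other pairs one `D_k` with `k ≥ 2` dominates, which keeps them from being `±1`
  when `d` exceeds the degrees of the powers of `b` involved (`exists_mem_Irr_of_unit`).
* If `A` has a nontrivial idempotent, `A[X]` is a product of two rings. On each factor the cycle
  runs along the path and back again, the second walk being shifted by a quarter of a turn. The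
  pairs of times that are not consecutive, but at which one walk has neighbouring positions, are
  different for the two walks, so that no chord is left (`exists_mem_Irr_of_isIdempotentElem`).

A finite ring with an element `a` other than `0` and `±1` always falls under one of these cases.
Some power of `a` is idempotent; if it is `0` then `1 + a X` is a unit of `A[X]`, and if it is `1`
then `a` is a unit (`ell_polynomial_eq_top`).
-/

open Polynomial

namespace LambdaQuiddity

/-! ### Continuants and the reducibility criterion -/

section General

variable {R : Type*} [CommRing R]

@[simp] theorem elemMat_zero_zero (x : R) : elemMat x 0 0 = x := rfl

@[simp] theorem elemMat_zero_one (x : R) : elemMat x 0 1 = -1 := rfl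

@[simp] theorem elemMat_one_zero (x : R) : elemMat x 1 0 = 1 := rfl

@[simp] theorem elemMat_one_one (x : R) : elemMat x 1 1 = 0 := rfl

@[simp] theorem M_nil : M ([] : List R) = 1 := rfl

theorem M_append (a b : List R) : M (a ++ b) = M b * M a := by
  simp [M]

theorem M_singleton (x : R) : M [x] = elemMat x := by
  simp [M]

theorem M_cons (x : R) (a : List R) : M (x :: a) = M a * elemMat x := by
  rw [← M_singleton, ← M_append]; rfl

theorem det_M (a : List R) : (M a).det = 1 := by
  induction a with
  | nil => simp
  | cons x a ih => rw [M_cons, Matrix.det_mul, ih]; simp [elemMat, Matrix.det_fin_two]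

/-- Reversing a tuple transposes `M` up to conjugation by `diag(1, -1)`. -/
theorem M_reverse (a : List R) :
    M a.reverse = !![M a 0 0, -M a 1 0; -M a 0 1, M a 1 1] := by
  induction a with
  | nil => ext i j; fin_cases i <;> fin_cases j <;> simp
  | cons x a ih =>
    rw [List.reverse_cons, M_append, M_singleton, ih, M_cons]
    ext i j
    fin_cases i <;> fin_cases j <;> simp [Matrix.mul_apply, Fin.sum_univ_two] <;> ring

theorem M_reverse_apply_zero (a : List R) : M a.reverse 0 0 = M a 0 0 := by
  simp [M_reverse]

theorem isQuiddity_cons_concat {y y' : R} {t : List R} (h : IsQuiddity (y :: (t ++ [y']))) :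
    M t 0 0 = 1 ∨ M t 0 0 = -1 := by
  have key : M (y :: (t ++ [y'])) 1 1 = -M t 0 0 := by
    rw [M_cons, M_append, M_singleton]
    simp [Matrix.mul_apply, Fin.sum_univ_two]
  rcases h.2 with h | h
  · rw [h] at key
    right
    rw [← neg_eq_iff_eq_neg, ← key]; simp
  · rw [h] at key
    left
    rw [← neg_inj, ← key]; simp

/-- A tuple whose continuant `M t 0 0` is `±1` can be completed on both sides to a `λ`-quiddity. -/
theorem exists_isQuiddity_cons_concat {t : List R} (h : M t 0 0 = 1 ∨ M t 0 0 = -1) :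
    ∃ y y' : R, IsQuiddity (y :: (t ++ [y'])) := by
  have hd := det_M t
  rw [Matrix.det_fin_two] at hd
  rcases h with h | h
  · refine ⟨-M t 0 1, M t 1 0, by simp, Or.inr ?_⟩
    rw [M_cons, M_append, M_singleton]
    rw [h] at hd
    ext i j
    fin_cases i <;> fin_cases j <;>
      simp [Matrix.mul_apply, Fin.sum_univ_two, h]
    linear_combination -hd
  · refine ⟨M t 0 1, -M t 1 0, by simp, Or.inl ?_⟩
    rw [M_cons, M_append, M_singleton]
    rw [h] at hd
    ext i j
    fin_cases i <;> fin_cases j <;>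
      simp [Matrix.mul_apply, Fin.sum_univ_two, h]
    linear_combination hd

theorem exists_eq_cons_concat {α : Type*} {a : List α} (h : 3 ≤ a.length) :
    ∃ x s x', s ≠ [] ∧ a = x :: (s ++ [x']) := by
  obtain _ | ⟨x, a⟩ := a
  · simp at h
  · rcases List.eq_nil_or_concat a with rfl | ⟨s, x', rfl⟩
    · simp at h
    · refine ⟨x, s, x', ?_, by simp⟩
      rintro rfl
      simp at h

/-- A tuple is reducible exactly when, cyclically, it has a proper block of consecutive entries with
continuant `±1`, short enough to leave at least three entries outside. -/
theorem isReducible_iff {c : List R} : IsReducible c ↔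
    ∃ u s v t, s ≠ [] ∧ t ≠ [] ∧ c ~r (u :: (s ++ v :: t)) ∧ (M t 0 0 = 1 ∨ M t 0 0 = -1) := by
  constructor
  · rintro ⟨a, b, hb, ha3, hb3, h⟩
    obtain ⟨x, s, x', hs, rfl⟩ := exists_eq_cons_concat ha3
    obtain ⟨y, t, y', ht, rfl⟩ := exists_eq_cons_concat hb3
    rw [oplus_eq] at h
    have hM := isQuiddity_cons_concat hb
    rcases h with h | h
    · exact ⟨_, s, _, t, hs, ht, h, hM⟩
    · refine ⟨x' + y, s.reverse, x + y', t.reverse, by simpa, by simpa, ?_, ?_⟩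
      · have h' := h.reverse
        rw [List.reverse_reverse] at h'
        refine h'.trans ?_
        have : ((x + y') :: (s ++ (x' + y) :: t)).reverse
            = t.reverse ++ ((x' + y) :: (s.reverse ++ [x + y'])) := by simp
        rw [this]
        refine List.isRotated_append.trans ?_
        rw [List.cons_append, List.append_assoc, List.singleton_append]
      · rwa [M_reverse_apply_zero]
  · rintro ⟨u, s, v, t, hs, ht, h, hM⟩
    obtain ⟨y, y', hq⟩ := exists_isQuiddity_cons_concat hM
    refine ⟨(u - y') :: (s ++ [v - y]), _, hq, ?_, ?_, Or.inl ?_⟩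
    · have := List.length_pos_iff.2 hs
      simp; omega
    · have := List.length_pos_iff.2 ht
      simp; omega
    · rw [oplus_eq]; simpa using h

/-! ### Chordless cycles of vectors -/

/-- The determinant of the matrix with columns `v` and `w`. -/
def cross (v w : R × R) : R := v.1 * w.2 - v.2 * w.1

/-- The matrix with rows `v` and `w`. -/
def rowMat (v w : R × R) : Matrix (Fin 2) (Fin 2) R := !![v.1, v.2; w.1, w.2]

/-- The tuple attached to a sequence of vectors with consecutive determinants `1` is the sequence of
coefficients of its three-term recurrence, so that `M` shifts pairs of consecutive vectors. -/
theorem M_map_mul_rowMat {v : ℕ → R × R} (hv : ∀ i, cross (v i) (v (i + 1)) = 1) (k l : ℕ) :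
    M ((List.range l).map fun i => cross (v (i + k)) (v (i + k + 2))) * rowMat (v (k + 1)) (v k) =
      rowMat (v (l + k + 1)) (v (l + k)) := by
  induction l with
  | zero => simp
  | succ l ih =>
    rw [List.range_succ, List.map_append, M_append, Matrix.mul_assoc, ih, List.map_singleton,
      M_singleton]
    have h1 := hv (l + k)
    have h2 := hv (l + k + 1)
    have e : l + 1 + k = l + k + 1 := by omega
    rw [e]
    simp only [cross] at h1 h2
    ext i j
    fin_cases i <;> fin_cases j <;>
      simp [elemMat, rowMat, cross]
    · linear_combination (v (l + k + 2)).1 * h1 + (v (l + k)).1 * h2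
    · linear_combination (v (l + k + 2)).2 * h1 + (v (l + k)).2 * h2

/-- Consecutive continuants of the tuple attached to a sequence of vectors are determinants of
pairs of vectors of the sequence. -/
theorem M_map_apply_zero {v : ℕ → R × R} (hv : ∀ i, cross (v i) (v (i + 1)) = 1) (k l : ℕ) :
    M ((List.range l).map fun i => cross (v (i + k)) (v (i + k + 2))) 0 0 =
      cross (v k) (v (l + k + 1)) := by
  have h := M_map_mul_rowMat hv k l
  have h1 := congrFun (congrFun h 0) 0
  have h2 := congrFun (congrFun h 0) 1
  have h3 := hv k
  simp [rowMat, Matrix.mul_apply, Fin.sum_univ_two] at h1 h2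
  generalize M ((List.range l).map fun i => cross (v (i + k)) (v (i + k + 2))) = m at h1 h2 ⊢
  simp only [cross] at h3 ⊢
  rw [← h1, ← h2]
  linear_combination -(m 0 0) * h3

theorem M_map_eq_one {v : ℕ → R × R} (hv : ∀ i, cross (v i) (v (i + 1)) = 1) {n : ℕ}
    (hn : ∀ i, v (i + n) = v i) :
    M ((List.range n).map fun i => cross (v i) (v (i + 2))) = 1 := by
  have h := M_map_mul_rowMat hv 0 n
  have e0 := hn 0
  have e1 := hn 1
  rw [zero_add] at e0
  rw [add_comm] at e1
  simp only [add_zero, zero_add] at h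
  rw [e0, e1] at h
  have hd : IsUnit (rowMat (v 1) (v 0)) := by
    rw [Matrix.isUnit_iff_isUnit_det]
    have := hv 0
    simp only [cross, zero_add] at this
    have : (rowMat (v 1) (v 0)).det = -1 := by
      rw [rowMat, Matrix.det_fin_two_of]; linear_combination -this
    rw [this]; exact isUnit_one.neg
  exact hd.mul_right_cancel (by rw [h, one_mul])

theorem cross_swap (v w : R × R) : cross w v = -cross v w := by
  simp only [cross]; ring

theorem rotate_map_range {α : Type*} {f : ℕ → α} {n : ℕ} (hf : ∀ i, f (i + n) = f i) (k : ℕ) :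
    ((List.range n).map f).rotate k = (List.range n).map fun i => f (i + k) := by
  have hmod : ∀ i, f (i % n) = f i := by
    intro i
    conv_rhs => rw [← Nat.mod_add_div i n]
    generalize i / n = q
    induction q with
    | zero => simp
    | succ q ih => rw [Nat.mul_succ, ← add_assoc, hf, ih]
  apply List.ext_getElem
  · simp
  · intro i h1 h2
    rw [List.getElem_rotate]
    simp [hmod]

/-- A cyclic sequence of `n` vectors of `R²` in which consecutive vectors have determinant `1` and
non-consecutive ones do not have determinant `±1` (a chordless cycle of the Farey graph of `R`)
yields an irreducible `λ`-quiddity of size `n`. -/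
theorem exists_mem_Irr_of_cycle {n : ℕ} (hn : 4 ≤ n) (v : ℕ → R × R)
    (hedge : ∀ i, i + 1 < n → cross (v i) (v (i + 1)) = 1)
    (hlast : cross (v (n - 1)) (v 0) = 1)
    (hchord : ∀ i j, i + 2 ≤ j → j < n → j ≠ i + (n - 1) →
      cross (v i) (v j) ≠ 1 ∧ cross (v i) (v j) ≠ -1) :
    ∃ c ∈ Irr R, c.length = n := by
  set w : ℕ → R × R := fun i => v (i % n) with hw
  have hper : ∀ i, w (i + n) = w i := fun i => by simp [hw]
  have hw1 : ∀ i, cross (w i) (w (i + 1)) = 1 := by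
    intro i
    have hlt := Nat.mod_lt i (show 0 < n by omega)
    simp only [hw, Nat.add_mod i 1 n, Nat.mod_eq_of_lt (show 1 < n by omega)]
    rcases Nat.lt_or_ge (i % n + 1) n with h | h
    · rw [Nat.mod_eq_of_lt h]; exact hedge _ h
    · have : i % n = n - 1 := by omega
      rw [this, show n - 1 + 1 = n by omega, Nat.mod_self]; exact hlast
  have hw2 : ∀ k l, 1 ≤ l → l + 3 ≤ n →
      ¬ (cross (w k) (w (l + k + 1)) = 1 ∨ cross (w k) (w (l + k + 1)) = -1) := by
    intro k l hl hln
    have hlt := Nat.mod_lt k (show 0 < n by omega)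
    have e : (l + k + 1) % n = (k % n + (l + 1)) % n := by
      rw [show l + k + 1 = k + (l + 1) by omega]; simp
    simp only [hw, e]
    generalize k % n = r at hlt
    rcases Nat.lt_or_ge (r + (l + 1)) n with h | h
    · rw [Nat.mod_eq_of_lt h, not_or]
      exact hchord _ _ (by omega) h (by omega)
    · rw [Nat.mod_eq_sub_mod h, Nat.mod_eq_of_lt (by omega), cross_swap, neg_inj, neg_eq_iff_eq_neg,
        or_comm, not_or]
      exact hchord _ _ (by omega) hlt (by omega)
  refine ⟨(List.range n).map fun i => cross (w i) (w (i + 2)),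
    ⟨⟨by simp; omega, Or.inl (M_map_eq_one hw1 hper)⟩, by simp; omega, ?_⟩, by simp⟩
  rw [isReducible_iff]
  rintro ⟨u, s, x, t, hs, ht, ⟨k, hk⟩, hM⟩
  rw [rotate_map_range (fun i => by rw [hper, show i + n + 2 = i + 2 + n by omega, hper])] at hk
  have hs' := List.length_pos_iff.2 hs
  have ht' := List.length_pos_iff.2 ht
  have hlen : n = s.length + t.length + 2 := by
    have := congrArg List.length hk
    simp at this; omega
  have htt : t = (List.range t.length).map fun i =>
      cross (w (i + (k + s.length + 2))) (w (i + (k + s.length + 2) + 2)) := by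
    apply List.ext_getElem
    · simp
    · intro i h1 h2
      have h3 : i + (s.length + 2) < ((List.range n).map fun i =>
        cross (w (i + k)) (w (i + k + 2))).length := by simp; omega
      have h4 := List.getElem_of_eq hk h3
      simp only [List.getElem_map, List.getElem_range] at h4 ⊢
      rw [show i + (k + s.length + 2) = i + (s.length + 2) + k by omega, h4]
      have h5 : u :: (s ++ x :: t) = (u :: (s ++ [x])) ++ t := by simp
      rw [List.getElem_of_eq h5, List.getElem_append_right (by simp)]
      simp
  rw [htt, M_map_apply_zero hw1] at hM
  exact hw2 _ _ ht' (by omega) hM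

theorem ell_eq_top (h : ∀ N : ℕ, ∃ c ∈ Irr R, N ≤ c.length) : ell R = ⊤ := by
  rw [ENat.eq_top_iff_forall_ge]
  intro N
  obtain ⟨c, hc, hN⟩ := h N
  exact (Nat.cast_le.2 hN).trans (le_iSup₂ (f := fun (c : List R) (_ : c ∈ Irr R) =>
    (c.length : ℕ∞)) c hc)

end General

/-! ### Small sizes -/

theorem lengths_of_isRotated {α : Type*} {c : List α} {u v : α} {s t : List α}
    (hs : s ≠ []) (ht : t ≠ []) (h : c ~r (u :: (s ++ v :: t))) :
    c.length = s.length + t.length + 2 ∧ 1 ≤ s.length ∧ 1 ≤ t.length := by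
  refine ⟨?_, List.length_pos_iff.2 hs, List.length_pos_iff.2 ht⟩
  rw [h.perm.length_eq]; simp; omega

section SmallSize

variable {R : Type*} [CommRing R]

theorem not_isReducible_of_length_eq_three {c : List R} (hc : c.length = 3) : ¬ IsReducible c := by
  rw [isReducible_iff]
  rintro ⟨u, s, v, t, hs, ht, h, -⟩
  have := lengths_of_isRotated hs ht h
  omega

theorem not_isReducible_of_length_eq_four {c : List R} (hc : c.length = 4)
    (h1 : ∀ x ∈ c, x ≠ 1 ∧ x ≠ -1) : ¬ IsReducible c := by
  rw [isReducible_iff]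
  rintro ⟨u, s, v, t, hs, ht, h, hM⟩
  have := lengths_of_isRotated hs ht h
  obtain ⟨x, rfl⟩ := List.length_eq_one_iff.1 (show t.length = 1 by omega)
  have hx := h1 x (h.perm.mem_iff.2 (by simp))
  rw [M_singleton, elemMat_zero_zero] at hM
  tauto

theorem isReducible_of_mem {c : List R} (hc : 4 ≤ c.length) {x : R} (hx : x ∈ c)
    (h : x = 1 ∨ x = -1) : IsReducible c := by
  obtain ⟨l, r, rfl⟩ := List.append_of_mem hx
  have hl : 3 ≤ (r ++ l).length := by simp at hc ⊢; omega
  obtain ⟨u, s, v, hs, hu⟩ := exists_eq_cons_concat hl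
  refine isReducible_iff.2 ⟨u, s, v, [x], hs, by simp, ?_, by simpa [M_singleton]⟩
  have e1 : l ++ x :: r = (l ++ [x]) ++ r := by simp
  have e2 : u :: (s ++ v :: [x]) = r ++ (l ++ [x]) := by
    rw [← List.append_assoc, hu]; simp
  rw [e1, e2]
  exact List.isRotated_append

theorem isReducible_of_zero_mem {c : List R} (hc : 5 ≤ c.length) (hx : 0 ∈ c) :
    IsReducible c := by
  obtain ⟨l, r, rfl⟩ := List.append_of_mem hx
  obtain ⟨y, m, hm⟩ : ∃ y m, r ++ l = y :: m := by
    apply List.exists_cons_of_length_pos; simp at hc ⊢; omega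
  have hl : 3 ≤ m.length := by
    have := congrArg List.length hm
    simp at this hc; omega
  obtain ⟨u, s, v, hs, rfl⟩ := exists_eq_cons_concat hl
  refine isReducible_iff.2 ⟨u, s, v, [0, y], hs, by simp, ?_, Or.inr ?_⟩
  · refine List.isRotated_append.trans ?_
    have e1 : 0 :: r ++ l = [0, y] ++ (u :: (s ++ [v])) := by
      rw [List.cons_append, hm]; rfl
    have e2 : u :: (s ++ v :: [0, y]) = (u :: (s ++ [v])) ++ [0, y] := by simp
    rw [e1, e2]
    exact List.isRotated_append
  · simp [M_cons, Matrix.mul_apply, Fin.sum_univ_two]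

theorem eq_of_isQuiddity_three {a b c : R} (h : IsQuiddity [a, b, c]) :
    [a, b, c] = [1, 1, 1] ∨ [a, b, c] = [-1, -1, -1] := by
  have e11 : M [a, b, c] 1 1 = -b := by simp [M_cons, Matrix.mul_apply, Fin.sum_univ_two]
  have e10 : M [a, b, c] 1 0 = b * a - 1 := by
    simp [M_cons, Matrix.mul_apply, Fin.sum_univ_two]; ring
  have e01 : M [a, b, c] 0 1 = 1 - c * b := by
    simp [M_cons, Matrix.mul_apply, Fin.sum_univ_two]; ring
  rcases h.2 with h | h <;> rw [h] at e11 e10 e01 <;> simp at e11 e10 e01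
  · obtain rfl : b = -1 := by linear_combination e11
    obtain rfl : a = -1 := by linear_combination e10
    obtain rfl : c = -1 := by linear_combination -e01
    simp
  · obtain rfl : b = 1 := by linear_combination -e11
    obtain rfl : a = 1 := by linear_combination -e10
    obtain rfl : c = 1 := by linear_combination e01
    simp

theorem M_one_one_one : M ([1, 1, 1] : List R) = -1 := by
  ext i j
  fin_cases i <;> fin_cases j <;> simp [M_cons, Matrix.mul_apply, Fin.sum_univ_two]

theorem M_neg_one : M ([-1, -1, -1] : List R) = 1 := by
  ext i j
  fin_cases i <;> fin_cases j <;> simp [M_cons, Matrix.mul_apply, Fin.sum_univ_two]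

theorem M_zero_left (P : R) : M [0, P, 0, -P] = 1 := by
  ext i j
  fin_cases i <;> fin_cases j <;> simp [M_cons, Matrix.mul_apply, Fin.sum_univ_two]

theorem M_zero_right (P : R) : M [P, 0, -P, 0] = 1 := by
  ext i j
  fin_cases i <;> fin_cases j <;> simp [M_cons, Matrix.mul_apply, Fin.sum_univ_two]

theorem eq_of_isQuiddity_four {a b c d : R} (h : IsQuiddity [a, b, c, d])
    (h0 : 0 ∈ [a, b, c, d]) :
    ∃ P : R, [a, b, c, d] = [0, P, 0, -P] ∨ [a, b, c, d] = [P, 0, -P, 0] := by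
  obtain ⟨ε, hε, hM⟩ : ∃ ε : R, ε * ε = 1 ∧ M [a, b, c, d] = ε • 1 := by
    rcases h.2 with h | h
    · exact ⟨1, by simp, by simpa using h⟩
    · exact ⟨-1, by simp, by simpa using h⟩
  -- The four entries of `elemMat d * elemMat c = ε • (elemMat b * elemMat a)⁻¹`.
  have e00 := congrFun (congrFun hM 0) 0
  have e01 := congrFun (congrFun hM 0) 1
  have e10 := congrFun (congrFun hM 1) 0
  have e11 := congrFun (congrFun hM 1) 1
  simp [M_cons, Matrix.mul_apply, Fin.sum_univ_two] at e00 e01 e10 e11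
  have hd : d = -(ε * b) := by
    linear_combination ε * (e01 - d * e11) - d * hε
  have hc : c = -(ε * a) := by
    linear_combination -e10 - a * e11
  have hab : a = 0 ∨ b = 0 := by
    simp only [List.mem_cons, List.not_mem_nil, or_false] at h0
    rcases h0 with h0 | h0 | h0 | h0
    · exact Or.inl h0.symm
    · exact Or.inr h0.symm
    · left; linear_combination (-a) * hε + ε * (h0 + hc)
    · right; linear_combination (-b) * hε + ε * (h0 + hd)
  rcases hab with rfl | rfl
  · obtain rfl : c = 0 := by simpa using hc
    obtain rfl : ε = 1 := by simpa using e11.symm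
    exact ⟨b, Or.inl (by simp [hd])⟩
  · obtain rfl : d = 0 := by simpa using hd
    obtain rfl : ε = 1 := by simpa using e11.symm
    exact ⟨a, Or.inr (by simp [hc])⟩

end SmallSize

/-! ### Polynomials over a domain with elements `0` and `±1` -/

section SmallField

variable {A : Type*} [CommRing A] [IsDomain A]

/-- If all entries are nonconstant polynomials, then the degrees of the continuants increase with
the size, so that none of them vanishes. -/
theorem degree_M_lt (l : List A[X]) (h : ∀ p ∈ l, 0 < p.degree) :
    (M l 1 0).degree < (M l 0 0).degree := by
  induction l using List.reverseRecOn with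
  | nil => simp
  | append_singleton l p ih =>
    have ih := ih fun q hq => h q (by simp [hq])
    have hp := h p (by simp)
    have hq : M l 0 0 ≠ 0 := by
      rintro h0; rw [h0] at ih; simp at ih
    rw [M_append, M_singleton]
    simp only [Matrix.mul_apply, Fin.sum_univ_two, elemMat_zero_zero, elemMat_zero_one,
      elemMat_one_zero, elemMat_one_one, one_mul, zero_mul, add_zero, neg_mul, ← sub_eq_add_neg]
    have hlt : (M l 0 0).degree < (p * M l 0 0).degree := by
      rw [degree_mul, degree_eq_natDegree hq, degree_eq_natDegree (ne_zero_of_degree_gt hp)]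
      rw [degree_eq_natDegree (ne_zero_of_degree_gt hp)] at hp
      norm_cast at hp ⊢
      omega
    rwa [degree_sub_eq_left_of_degree_lt (ih.trans hlt)]

theorem exists_degree_le_zero_of_isQuiddity {c : List A[X]} (h : IsQuiddity c) :
    ∃ p ∈ c, p.degree ≤ 0 := by
  by_contra! hc
  rcases List.eq_nil_or_concat c with rfl | ⟨l, p, rfl⟩
  · simp [IsQuiddity] at h
  · have hl := degree_M_lt l fun q hq => hc q (by simp [hq])
    have h0 : M (l ++ [p]) 1 0 = M l 0 0 := by
      simp [M_append, M_singleton, Matrix.mul_apply, Fin.sum_univ_two]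
    have h1 : M (l ++ [p]) 1 0 = 0 := by
      rw [List.concat_eq_append] at h
      rcases h.2 with h | h <;> rw [h] <;> simp
    rw [← h0, h1] at hl
    simp at hl

/-- The irreducible `λ`-quiddities over `A[X]` when `A` is a domain whose only elements are
`0` and `±1`. -/
theorem Irr_polynomial_eq (hA : ∀ a : A, a = 0 ∨ a = 1 ∨ a = -1) :
    Irr A[X] = {c | c = [1, 1, 1] ∨ c = [-1, -1, -1] ∨
      ∃ P : A[X], P ≠ 1 ∧ P ≠ -1 ∧ (c = [0, P, 0, -P] ∨ c = [P, 0, -P, 0])} := by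
  ext c
  constructor
  · rintro ⟨hq, h3, hr⟩
    rcases h3.eq_or_lt with h3 | h3
    · obtain ⟨a, b, d, rfl⟩ := List.length_eq_three.1 h3.symm
      rcases eq_of_isQuiddity_three hq with h | h <;> simp [h]
    · have h1 : ∀ x ∈ c, x ≠ 1 ∧ x ≠ -1 := fun x hx => by
        rw [← not_or]; exact fun h => hr (isReducible_of_mem h3 hx h)
      have h0 : 0 ∈ c := by
        obtain ⟨p, hp, hd⟩ := exists_degree_le_zero_of_isQuiddity hq
        obtain ⟨h2, h4⟩ := h1 p hp
        rw [eq_C_of_degree_le_zero hd] at h2 h4 hp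
        rcases hA (p.coeff 0) with h | h | h <;> rw [h] at h2 h4 hp <;> simp_all
      have h4 : c.length = 4 := by
        by_contra h4
        exact hr (isReducible_of_zero_mem (by omega) h0)
      obtain ⟨a, b, d, e, rfl⟩ : ∃ a b d e, c = [a, b, d, e] := by
        match c, h4 with
        | [a, b, d, e], _ => exact ⟨a, b, d, e, rfl⟩
      obtain ⟨P, hP⟩ := eq_of_isQuiddity_four hq h0
      have hm : P ∈ [a, b, d, e] := by rcases hP with h | h <;> simp [h]
      exact Or.inr (Or.inr ⟨P, (h1 P hm).1, (h1 P hm).2, hP⟩)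
  · rintro (rfl | rfl | ⟨P, hP, hP', rfl | rfl⟩)
    · exact ⟨⟨by simp, Or.inr M_one_one_one⟩, by simp, not_isReducible_of_length_eq_three rfl⟩
    · exact ⟨⟨by simp, Or.inl M_neg_one⟩, by simp, not_isReducible_of_length_eq_three rfl⟩
    · exact ⟨⟨by simp, Or.inl (M_zero_left P)⟩, by simp,
        not_isReducible_of_length_eq_four rfl (by simp [hP, hP', neg_eq_iff_eq_neg])⟩
    · exact ⟨⟨by simp, Or.inl (M_zero_right P)⟩, by simp,
        not_isReducible_of_length_eq_four rfl (by simp [hP, hP', neg_eq_iff_eq_neg])⟩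

theorem ell_polynomial_eq_four (hA : ∀ a : A, a = 0 ∨ a = 1 ∨ a = -1) : ell A[X] = 4 := by
  have hIrr := Irr_polynomial_eq hA
  apply le_antisymm
  · refine iSup₂_le fun c hc => ?_
    rw [hIrr] at hc
    rcases hc with rfl | rfl | ⟨P, -, -, rfl | rfl⟩ <;> norm_num
  · have h0 : [0, 0, 0, 0] ∈ Irr A[X] := by
      rw [hIrr]
      exact Or.inr (Or.inr ⟨0, by simp, by simp, by simp⟩)
    exact le_iSup₂ (f := fun (c : List A[X]) (_ : c ∈ Irr A[X]) => (c.length : ℕ∞)) _ h0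

theorem zmod_eq_zero_or_one_or_neg_one {k : ℕ} (hk : k = 2 ∨ k = 3) (a : ZMod k) :
    a = 0 ∨ a = 1 ∨ a = -1 := by
  rcases hk with rfl | rfl <;> revert a <;> decide

end SmallField

/-! ### A path in the Farey graph -/

section Cross

variable {R : Type*} [CommRing R] (u v w : R × R) (a : R)

theorem cross_self : cross v v = 0 := by simp only [cross]; ring

theorem cross_neg_left : cross (-v) w = -cross v w := by simp [cross]; ring

theorem cross_neg_right : cross v (-w) = -cross v w := by simp [cross]; ring

theorem cross_smul_left : cross (a • v) w = a * cross v w := by simp [cross]; ring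

theorem cross_smul_right : cross v (a • w) = a * cross v w := by simp [cross]; ring

theorem cross_add_left : cross (u + v) w = cross u w + cross v w := by simp [cross]; ring

theorem cross_add_right : cross u (v + w) = cross u v + cross u w := by simp [cross]; ring

/-- The continuants of the constant tuples `(T, …, T)`, shifted so that `contin T (k + 1)` is the
continuant of size `k` (rescaled Chebyshev polynomials of the second kind, evaluated at `T`). -/
def contin (T : R) : ℕ → R
  | 0 => 0
  | 1 => 1
  | k + 2 => T * contin T (k + 1) - contin T k

/-- An infinite path in the Farey graph of `R`, with `cross (path T i) (path T (i + k))` equal to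
`contin T k`. -/
def path (T : R) (i : ℕ) : R × R := (contin T (i + 1), contin T i)

theorem cross_path_add (T : R) (i k : ℕ) : cross (path T i) (path T (i + k)) = contin T k := by
  induction k using Nat.twoStepInduction with
  | zero => simp [cross_self, contin]
  | one =>
    induction i with
    | zero => simp [cross, path, contin]
    | succ i ih =>
      simp only [cross, path, contin] at ih ⊢
      linear_combination ih
  | more k h1 h2 =>
    have e0 : contin T (k + 2) = T * contin T (k + 1) - contin T k := rfl
    have e1 : contin T (i + k + 2) = T * contin T (i + k + 1) - contin T (i + k) := rfl
    have e2 : contin T (i + k + 3) = T * contin T (i + k + 2) - contin T (i + k + 1) := rfl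
    rw [e0, ← h1, ← h2]
    change contin T (i + 1) * contin T (i + k + 2) - contin T i * contin T (i + k + 3) =
      T * (contin T (i + 1) * contin T (i + k + 1) - contin T i * contin T (i + k + 2)) -
        (contin T (i + 1) * contin T (i + k) - contin T i * contin T (i + k + 1))
    linear_combination contin T (i + 1) * e1 - contin T i * e2

theorem cross_path_of_le (T : R) {i j : ℕ} (h : i ≤ j) :
    cross (path T i) (path T j) = contin T (j - i) := by
  rw [← cross_path_add T i, Nat.add_sub_cancel' h]

theorem cross_path_of_ge (T : R) {i j : ℕ} (h : j ≤ i) :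
    cross (path T i) (path T j) = -contin T (i - j) := by
  rw [cross_swap, cross_path_of_le T h]

end Cross

/-! ### Degrees of the continuants -/

section Degree

variable {A : Type*} [CommRing A] {d : ℕ}

theorem contin_X_pow [Nontrivial A] (hd : 0 < d) (k : ℕ) :
    (contin (X ^ d : A[X]) (k + 1)).Monic ∧
      (contin (X ^ d : A[X]) (k + 1)).natDegree = d * k ∧
      (contin (X ^ d : A[X]) k).degree < (contin (X ^ d : A[X]) (k + 1)).degree := by
  induction k with
  | zero => simp [contin]
  | succ k ih =>
    obtain ⟨hm, hn, hlt⟩ := ih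
    have hm' : (X ^ d * contin (X ^ d : A[X]) (k + 1)).Monic := (monic_X_pow d).mul hm
    have hn' : (X ^ d * contin (X ^ d : A[X]) (k + 1)).natDegree = d * (k + 1) := by
      rw [(monic_X_pow d).natDegree_mul hm, natDegree_X_pow, hn]; ring
    have hlt' : (contin (X ^ d : A[X]) (k + 1)).degree <
        (X ^ d * contin (X ^ d : A[X]) (k + 1)).degree := by
      rw [degree_eq_natDegree hm.ne_zero, degree_eq_natDegree hm'.ne_zero, hn, hn']
      norm_cast
      nlinarith
    simp only [contin]
    have hdeg := degree_sub_eq_left_of_degree_lt (hlt.trans hlt')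
    refine ⟨hm'.sub_of_left (hlt.trans hlt'), ?_, by rwa [hdeg]⟩
    rw [natDegree_eq_of_degree_eq hdeg, hn']

theorem contin_mem_degreeLT [Nontrivial A] (hd : 0 < d) (k : ℕ) :
    contin (X ^ d : A[X]) k ∈ degreeLT A (d * k + 1) := by
  rw [mem_degreeLT]
  have h := (contin_X_pow (A := A) hd k).2
  refine h.2.trans_le (degree_le_natDegree.trans ?_)
  rw [h.1]
  exact_mod_cast Nat.le_succ _

theorem mul_mem_degreeLT {m n : ℕ} {p q : A[X]} (hp : p ∈ degreeLT A m)
    (hq : q ∈ degreeLT A (n + 1)) : p * q ∈ degreeLT A (n + m) := by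
  rw [mem_degreeLT] at *
  by_cases h0 : p = 0
  · subst h0; simp [bot_lt_iff_ne_bot]
  by_cases h1 : q = 0
  · subst h1; simp [bot_lt_iff_ne_bot]
  refine (degree_mul_le p q).trans_lt ?_
  rw [degree_eq_natDegree h0] at hp ⊢
  rw [degree_eq_natDegree h1] at hq ⊢
  norm_cast at *
  omega

/-- The degrees of the continuants in `X ^ d` are too far apart for a linear relation between three
consecutive ones whose leading coefficient `β` is a unit and whose other coefficients, once divided
by `β`, have degree less than `d`. -/
theorem contin_ne [Nontrivial A] (hd : 0 < d) {k : ℕ} {β β' g h r : A[X]} (hβ : β' * β = 1)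
    (hg : β' * g ∈ degreeLT A d) (hh : β' * h ∈ degreeLT A d) (hr : β' * r ∈ degreeLT A d) :
    β * contin (X ^ d : A[X]) (k + 2) + g * contin (X ^ d : A[X]) (k + 1) +
      h * contin (X ^ d : A[X]) k ≠ r := by
  intro H
  have H' : contin (X ^ d : A[X]) (k + 2) =
      β' * r - β' * g * contin (X ^ d : A[X]) (k + 1) - β' * h * contin (X ^ d : A[X]) k := by
    linear_combination β' * H - contin (X ^ d : A[X]) (k + 2) * hβ
  have hmem : contin (X ^ d : A[X]) (k + 2) ∈ degreeLT A (d * k + d) := by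
    rw [H']
    have h1 : contin (X ^ d : A[X]) (k + 1) ∈ degreeLT A (d * k + 1) := by
      rw [mem_degreeLT]
      have h2 := contin_X_pow (A := A) hd k
      rw [degree_eq_natDegree h2.1.ne_zero, h2.2.1]
      norm_cast
      omega
    exact sub_mem (sub_mem (degreeLT_mono (by omega) hr) (mul_mem_degreeLT hg h1))
      (mul_mem_degreeLT hh (contin_mem_degreeLT hd k))
  have h3 := contin_X_pow (A := A) hd (k + 1)
  rw [mem_degreeLT, degree_eq_natDegree h3.1.ne_zero, h3.2.1] at hmem
  norm_cast at hmem
  exact absurd hmem (by rw [Nat.mul_succ]; exact lt_irrefl _)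

/-- The nonzero scalar multiples of the continuants of positive size in `X` are not constant. -/
theorem eq_one_of_C_mul_contin [Nontrivial A] {e r : A} (he : e ≠ 0) (hr : r ≠ 0) {k : ℕ}
    (h : C e * contin (X : A[X]) k = C r) : k = 1 := by
  obtain _ | k := k
  · simp only [contin, mul_zero] at h
    exact absurd (C_eq_zero.1 h.symm) hr
  · have h1 := contin_X_pow (A := A) one_pos k
    rw [pow_one, one_mul] at h1
    have h2 := congrArg natDegree h
    rw [natDegree_C, natDegree_mul' (by simpa [h1.1.leadingCoeff]), natDegree_C, h1.2.1] at h2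
    omega

end Degree

/-! ### Chordless cycles from a unit -/

section UnitCycle

variable {A : Type*} [CommRing A] [Nontrivial A]

/-- The returning run of a cycle whose first run is `path T 0, …, path T N`: the `l`-th vector of
the path is scaled by `b` or `-b⁻¹` according to the parity of `l`, and the two end vectors are
perturbed by their neighbours so that they are joined by edges to the unscaled ones. Here `c` stands
for `b⁻¹`, and `N` is even. -/
noncomputable def returnPath (T b c : A[X]) (N l : ℕ) : A[X] × A[X] :=
  if l = 0 then -(c • path T 0 + path T 1)
  else if l = N then -(c • path T N + path T (N - 1))
  else (if Even l then -c else b) • path T l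

theorem exists_mem_Irr_of_unit {b c : A[X]} (hbc : b * c = 1) (hb : b ≠ 1) (hb' : b ≠ -1) (N : ℕ)
    (hN : Even N) (hN2 : 2 ≤ N) : ∃ l ∈ Irr A[X], l.length = 2 * N + 2 := by
  obtain ⟨d, hd, hb1, hc1, hb2, hc2⟩ : ∃ d, 0 < d ∧ b ∈ degreeLT A d ∧ c ∈ degreeLT A d ∧
      b * b ∈ degreeLT A d ∧ c * c ∈ degreeLT A d := by
    have key : ∀ (p : A[X]) (n : ℕ), p.natDegree < n → p ∈ degreeLT A n := fun p n h => by
      rw [mem_degreeLT]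
      exact degree_le_natDegree.trans_lt (by exact_mod_cast h)
    refine ⟨b.natDegree + c.natDegree + (b * b).natDegree + (c * c).natDegree + 1, by omega,
      ?_, ?_, ?_, ?_⟩ <;> apply key <;> omega
  have h1 : (1 : A[X]) ∈ degreeLT A d := by
    rw [mem_degreeLT, degree_one]; exact_mod_cast hd
  have hcb : c * b = 1 := by rw [mul_comm, hbc]
  have hc : c ≠ 1 := by rintro rfl; exact hb (by simpa using hbc)
  have hc' : c ≠ -1 := by rintro rfl; exact hb' (by linear_combination -hbc)
  set T : A[X] := X ^ d with hT
  have pm_neg : ∀ x : A[X], x ≠ 1 ∧ x ≠ -1 → -x ≠ 1 ∧ -x ≠ -1 := fun x hx =>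
    ⟨fun h => hx.2 (by rw [← h, neg_neg]), fun h => hx.1 (by simpa using h)⟩
  -- Up to sign, the determinants of vectors at least two steps apart along the path have one of the
  -- three forms treated in `far`, `far_end` and `far_ends`.
  have far : ∀ k ≥ 2, ∀ β β' : A[X], β' * β = 1 → β' ∈ degreeLT A d →
      β * contin T k ≠ 1 ∧ β * contin T k ≠ -1 := by
    intro k hk β β' hβ hβ'
    obtain ⟨k, rfl⟩ := Nat.exists_eq_add_of_le' hk
    constructor <;> intro h
    · exact contin_ne hd (k := k) (g := 0) (h := 0) (r := 1) hβ (by simp) (by simp)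
        (by simpa using hβ') (by simpa using h)
    · exact contin_ne hd (k := k) (g := 0) (h := 0) (r := -1) hβ (by simp) (by simp)
        (by simpa using hβ') (by simpa using h)
  have far_end : ∀ k ≥ 2, ∀ β β' : A[X], β' * β = 1 → b * β' ∈ degreeLT A d →
      β * (c * contin T k + contin T (k - 1)) ≠ 1 ∧
        β * (c * contin T k + contin T (k - 1)) ≠ -1 := by
    intro k hk β β' hβ hβ'
    obtain ⟨k, rfl⟩ := Nat.exists_eq_add_of_le' hk
    have e : b * β' * (β * c) = 1 := by linear_combination b * c * hβ + hbc
    have e2 : b * β' * β = b := by linear_combination b * hβ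
    constructor <;> intro h
    · exact contin_ne hd (k := k) (β := β * c) (β' := b * β') (g := β) (h := 0) (r := 1)
        e (by rwa [e2]) (by simp) (by simpa using hβ') (by rw [← h]; simp; ring)
    · exact contin_ne hd (k := k) (β := β * c) (β' := b * β') (g := β) (h := 0) (r := -1)
        e (by rwa [e2]) (by simp) (by simpa using hβ') (by rw [← h]; simp; ring)
  have far_ends : ∀ k ≥ 2, c * c * contin T k + (c + c) * contin T (k - 1) + contin T (k - 2) ≠ 1 ∧
      c * c * contin T k + (c + c) * contin T (k - 1) + contin T (k - 2) ≠ -1 := by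
    intro k hk
    obtain ⟨k, rfl⟩ := Nat.exists_eq_add_of_le' hk
    have e : b * b * (c * c) = 1 := by linear_combination (b * c + 1) * hbc
    have e2 : b * b * (c + c) = b + b := by linear_combination 2 * b * hbc
    constructor <;> intro h
    · exact contin_ne hd (k := k) (β := c * c) (β' := b * b) (g := c + c) (h := 1) (r := 1)
        e (by rw [e2]; exact add_mem hb1 hb1) (by simpa using hb2) (by simpa using hb2)
        (by rw [one_mul]; exact h)
    · exact contin_ne hd (k := k) (β := c * c) (β' := b * b) (g := c + c) (h := 1) (r := -1)
        e (by rw [e2]; exact add_mem hb1 hb1) (by simpa using hb2) (by simpa using hb2)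
        (by rw [one_mul]; exact h)
  have c0 : contin T 0 = 0 := rfl
  have c1 : contin T 1 = 1 := rfl
  set w := returnPath T b c N with hw
  have w0 : w 0 = -(c • path T 0 + path T 1) := by simp [hw, returnPath]
  have wN : w N = -(c • path T N + path T (N - 1)) := by
    simp [hw, returnPath, show N ≠ 0 by omega]
  -- The scaling factors of the inner vectors of the returning path, and their inverses.
  obtain ⟨β, β', hββ', hβ, hwβ, hβn, hβodd⟩ : ∃ β β' : ℕ → A[X], (∀ l, β' l * β l = 1) ∧
      (∀ l, (β l = b ∧ β' l = c) ∨ (β l = -c ∧ β' l = -b)) ∧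
      (∀ l, l ≠ 0 → l ≠ N → w l = β l • path T l) ∧ (∀ l, β (l + 1) * β l = -1) ∧
      ∀ l, ¬ Even l → β l = b := by
    refine ⟨fun l => if Even l then -c else b, fun l => if Even l then -b else c,
      ?_, ?_, ?_, ?_, ?_⟩
    · intro l; dsimp only; split_ifs <;> simp [hbc, hcb]
    · intro l; dsimp only; split_ifs <;> simp
    · intro l h0 hl; simp [hw, returnPath, h0, hl]
    · intro l
      by_cases h : Even l <;> simp [h, Nat.even_add_one, hbc, hcb]
    · intro l h; simp [h]
  have hβ1 : ∀ l, β l ≠ 1 ∧ β l ≠ -1 := by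
    intro l
    rcases hβ l with h | h <;> rw [h.1]
    · exact ⟨hb, hb'⟩
    · exact pm_neg _ ⟨hc, hc'⟩
  have hβd : ∀ l, β' l ∈ degreeLT A d := by
    intro l
    rcases hβ l with h | h <;> rw [h.2]
    · exact hc1
    · exact neg_mem hb1
  have hbβd : ∀ l, b * β' l ∈ degreeLT A d := by
    intro l
    rcases hβ l with h | h <;> rw [h.2]
    · rwa [hbc]
    · rw [mul_neg]; exact neg_mem hb2
  have hββd : ∀ l l', β' l * β' l' ∈ degreeLT A d := by
    intro l l'
    rcases hβ l with h | h <;> rcases hβ l' with h' | h' <;> rw [h.2, h'.2]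
    · exact hc2
    · rw [mul_neg, hcb]; exact neg_mem h1
    · rw [neg_mul, hbc]; exact neg_mem h1
    · rwa [neg_mul_neg]
  have hββ2 : ∀ l l', β' l * β' l' * (β l * β l') = 1 := fun l l' => by
    linear_combination β' l' * β l' * hββ' l + hββ' l'
  have edge : ∀ i, cross (path T i) (path T (i + 1)) = 1 := fun i => by rw [cross_path_add, c1]
  -- Non-consecutive vectors, one on each run.
  have chord_pw : ∀ i ≤ N, ∀ l ≤ N, ¬ (i = 0 ∧ l = 0) → ¬ (i = N ∧ l = N) →
      cross (path T i) (w l) ≠ 1 ∧ cross (path T i) (w l) ≠ -1 := by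
    intro i hi l hl h0 hNN
    rcases Nat.eq_zero_or_pos l with rfl | hl0
    · have e : cross (path T i) (w 0) = c * contin T i + contin T (i - 1) := by
        rw [w0, cross_neg_right, cross_add_right, cross_smul_right, cross_path_of_ge T (by omega),
          cross_path_of_ge T (by omega)]
        simp; ring
      rw [e]
      rcases Nat.lt_or_ge i 2 with h | h
      · obtain rfl : i = 1 := by omega
        simp only [c1, Nat.sub_self, c0, mul_one, add_zero]
        exact ⟨hc, hc'⟩
      · simpa using far_end i h 1 1 (by simp) (by simpa using hb1)
    rcases hl.eq_or_lt with rfl | hlN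
    · have e : cross (path T i) (w l) = -(c * contin T (l - i) + contin T (l - i - 1)) := by
        rw [wN, cross_neg_right, cross_add_right, cross_smul_right, cross_path_of_le T (by omega),
          cross_path_of_le T (by omega), show l - 1 - i = l - i - 1 by omega]
      rw [e]
      apply pm_neg
      rcases Nat.lt_or_ge (l - i) 2 with h | h
      · have h : l - i = 1 := by omega
        simp only [h, c1, Nat.sub_self, c0, mul_one, add_zero]
        exact ⟨hc, hc'⟩
      · simpa using far_end _ h 1 1 (by simp) (by simpa using hb1)
    rw [hwβ l (by omega) (by omega), cross_smul_right]
    have main : ∀ k, β l * contin T k ≠ 1 ∧ β l * contin T k ≠ -1 := by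
      intro k
      match k with
      | 0 => simp [c0, eq_comm]
      | 1 => simpa [c1] using hβ1 l
      | k + 2 => exact far (k + 2) (by omega) _ _ (hββ' l) (hβd l)
    rcases le_total i l with h | h
    · rw [cross_path_of_le T h]; exact main _
    · rw [cross_path_of_ge T h, mul_neg]; exact pm_neg _ (main _)
  -- Non-consecutive vectors of the returning run.
  have chord_ww : ∀ l ≤ N, ∀ l', l' + 2 ≤ l →
      cross (w l) (w l') ≠ 1 ∧ cross (w l) (w l') ≠ -1 := by
    intro l hl l' hl'
    rcases hl.eq_or_lt with rfl | hlN
    · rcases Nat.eq_zero_or_pos l' with rfl | hl0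
      · have e : cross (w l) (w 0) =
            -(c * c * contin T l + (c + c) * contin T (l - 1) + contin T (l - 2)) := by
          rw [wN, w0, cross_neg_left, cross_neg_right, cross_add_left, cross_add_right,
            cross_add_right, cross_smul_left, cross_smul_right, cross_smul_right, cross_smul_left,
            cross_path_of_ge T (by omega), cross_path_of_ge T (by omega),
            cross_path_of_ge T (by omega), cross_path_of_ge T (by omega),
            show l - 1 - 1 = l - 2 by omega]
          simp only [Nat.sub_zero]; ring
        rw [e]
        exact pm_neg _ (far_ends l hN2)
      · have e : cross (w l) (w l') = β l' * (c * contin T (l - l') + contin T (l - l' - 1)) := by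
          rw [wN, hwβ l' (by omega) (by omega), cross_neg_left, cross_add_left, cross_smul_left,
            cross_smul_right, cross_smul_right, cross_path_of_ge T (by omega),
            cross_path_of_ge T (by omega), show l - 1 - l' = l - l' - 1 by omega]
          ring
        rw [e]
        exact far_end _ (by omega) _ _ (hββ' l') (hbβd l')
    rcases Nat.eq_zero_or_pos l' with rfl | hl0
    · have e : cross (w l) (w 0) = β l * (c * contin T l + contin T (l - 1)) := by
        rw [w0, hwβ l (by omega) (by omega), cross_neg_right, cross_add_right, cross_smul_left,
          cross_smul_right, cross_smul_left, cross_path_of_ge T (by omega),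
          cross_path_of_ge T (by omega)]
        simp only [Nat.sub_zero]; ring
      rw [e]
      exact far_end _ (by omega) _ _ (hββ' l) (hbβd l)
    · have e : cross (w l) (w l') = -(β l * β l' * contin T (l - l')) := by
        rw [hwβ l (by omega) (by omega), hwβ l' (by omega) (by omega), cross_smul_left,
          cross_smul_right, cross_path_of_ge T (by omega)]
        ring
      rw [e]
      exact pm_neg _ (far _ (by omega) _ _ (hββ2 l l') (hββd l l'))
  have edge_w : ∀ l < N, cross (w (l + 1)) (w l) = 1 := by
    intro l hl
    rcases Nat.eq_zero_or_pos l with rfl | hl0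
    · rw [hwβ 1 one_ne_zero (by omega), hβodd 1 (by simp), w0, cross_neg_right, cross_add_right,
        cross_smul_left, cross_smul_left, cross_smul_right, cross_self,
        cross_path_of_ge T (by omega), c1]
      linear_combination hbc
    rcases (Nat.succ_le_of_lt hl).eq_or_lt with h | hlN
    · obtain rfl : N = l + 1 := h.symm
      have hodd : ¬ Even l := by rwa [Nat.even_add_one] at hN
      rw [wN, hwβ l (by omega) (by omega), hβodd l hodd, cross_neg_left, cross_add_left,
        cross_smul_left, cross_smul_right, cross_smul_right, Nat.add_sub_cancel, cross_self,
        cross_path_of_ge T (by omega), Nat.add_sub_cancel_left, c1]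
      linear_combination hbc
    · rw [hwβ l (by omega) (by omega), hwβ (l + 1) (by omega) (by omega), cross_smul_left,
        cross_smul_right, cross_path_of_ge T (by omega), Nat.add_sub_cancel_left, c1]
      linear_combination -hβn l
  apply exists_mem_Irr_of_cycle (by omega)
    fun i => if i ≤ N then path T i else w (2 * N + 1 - i)
  · intro i hi
    rcases lt_trichotomy i N with h | rfl | h
    · rw [if_pos h.le, if_pos (by omega), edge]
    · rw [if_pos le_rfl, if_neg (by omega), show 2 * i + 1 - (i + 1) = i by omega, wN,
        cross_neg_right, cross_add_right, cross_smul_right, cross_self,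
        cross_path_of_ge T (by omega), show i - (i - 1) = 1 by omega, c1]
      ring
    · rw [if_neg (by omega), if_neg (by omega),
        show 2 * N + 1 - i = 2 * N + 1 - (i + 1) + 1 by omega]
      exact edge_w _ (by omega)
  · rw [if_neg (by omega), if_pos (by omega), show 2 * N + 1 - (2 * N + 2 - 1) = 0 by omega, w0,
      cross_neg_left, cross_add_left, cross_smul_left, cross_self,
      cross_path_of_ge T (by omega), c1]
    ring
  · intro i j hij hj hne
    split_ifs with h2 h3 h3
    · rw [cross_path_of_le T (by omega)]
      simpa using far (j - i) (by omega) 1 1 (by simp) h1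
    · exact chord_pw i h2 _ (by omega) (by omega) (by omega)
    · omega
    · exact chord_ww _ (by omega) _ (by omega)

end UnitCycle

/-! ### Chordless cycles from an idempotent -/

section IdempotentCycle

variable {R : Type*} [CommRing R]

/-- Position at time `i ≤ 4 * s` of a walk from `0` to `2 * s` and back. -/
def fold (s i : ℕ) : ℕ := if i ≤ 2 * s then i else 4 * s - i

/-- The closed walk of length `4 * s` in the Farey graph that runs along `path T` up to
`path T (2 * s)` and comes back; the alternating signs make consecutive determinants equal
to `1`. -/
def backForth (T : R) (s i : ℕ) : R × R :=
  (if i ≤ 2 * s then (1 : R) else (-1) ^ i) • path T (fold s i)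

theorem backForth_last (T : R) (s : ℕ) : backForth T s (4 * s) = backForth T s 0 := by
  have : Even (4 * s) := ⟨2 * s, by ring⟩
  rcases Nat.eq_zero_or_pos s with rfl | hs
  · rfl
  · simp [backForth, fold, this.neg_one_pow, show ¬ 4 * s ≤ 2 * s by omega]

theorem cross_backForth_succ (T : R) (s : ℕ) {i : ℕ} (hi : i < 4 * s) :
    cross (backForth T s i) (backForth T s (i + 1)) = 1 := by
  have c1 : contin T 1 = 1 := rfl
  rw [backForth, backForth, cross_smul_left, cross_smul_right]
  rcases lt_trichotomy i (2 * s) with h | rfl | h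
  · rw [if_pos h.le, if_pos (by omega), fold, fold, if_pos h.le, if_pos (by omega),
      cross_path_add, c1]
    simp
  · rw [if_pos le_rfl, if_neg (by omega), fold, fold, if_pos le_rfl, if_neg (by omega),
      cross_path_of_ge T (by omega), show 2 * s - (4 * s - (2 * s + 1)) = 1 by omega, c1,
      pow_succ, pow_mul]
    simp
  · rw [if_neg (by omega), if_neg (by omega), fold, fold, if_neg (by omega), if_neg (by omega),
      cross_path_of_ge T (by omega), show 4 * s - i - (4 * s - (i + 1)) = 1 by omega, c1,
      pow_succ]
    have : ((-1 : R) ^ i) * (-1) ^ i = 1 := by rw [← mul_pow]; simp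
    linear_combination this

theorem cross_backForth (T : R) (s i j : ℕ) : ∃ ε : R, (ε = 1 ∨ ε = -1) ∧
    cross (backForth T s i) (backForth T s j) =
      ε * contin T ((fold s i - fold s j) + (fold s j - fold s i)) := by
  have hpow : ∀ i, ((-1 : R) ^ i = 1 ∨ (-1 : R) ^ i = -1) := neg_one_pow_eq_or R
  have hsgn : ∀ i, ((if i ≤ 2 * s then 1 else (-1) ^ i : R) = 1 ∨
      (if i ≤ 2 * s then 1 else (-1) ^ i : R) = -1) := by
    intro i; split_ifs
    · exact Or.inl rfl
    · exact hpow i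
  have hmul : ∀ {x y : R}, (x = 1 ∨ x = -1) → (y = 1 ∨ y = -1) → (x * y = 1 ∨ x * y = -1) := by
    rintro x y (rfl | rfl) (rfl | rfl) <;> simp
  rw [backForth, backForth, cross_smul_left, cross_smul_right]
  have h12 := hmul (hsgn i) (hsgn j)
  rcases le_total (fold s i) (fold s j) with h | h
  · refine ⟨_, h12, ?_⟩
    rw [cross_path_of_le T h, Nat.sub_eq_zero_of_le h, zero_add]; ring
  · refine ⟨_, hmul h12 (Or.inr rfl : (-1 : R) = 1 ∨ (-1 : R) = -1), ?_⟩
    rw [cross_path_of_ge T h, Nat.sub_eq_zero_of_le h, add_zero]; ring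

theorem cross_idempotent {e : R} (he : e * e = e) (v w v' w' : R × R) :
    cross (e • v + (1 - e) • w) (e • v' + (1 - e) • w') =
      e * cross v v' + (1 - e) * cross w w' := by
  simp only [cross, Prod.fst_add, Prod.snd_add, Prod.smul_fst, Prod.smul_snd, smul_eq_mul]
  linear_combination (v.1 * v'.2 - v.2 * v'.1 + w.1 * w'.2 - w.2 * w'.1 -
    v.1 * w'.2 - w.1 * v'.2 + v.2 * w'.1 + w.2 * v'.1) * he

end IdempotentCycle

section IdempotentPolynomial

variable {A : Type*} [CommRing A]

/-- Multiplied by a nonzero scalar `e`, the determinant of two vectors of `backForth` can only agree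
with `±1` when their positions on the path are neighbours. -/
theorem fold_eq_of_cross [Nontrivial A] {e : A} (he : e ≠ 0) {s i j : ℕ} {r : A[X]}
    (hr : r = 1 ∨ r = -1) (h : C e * cross (backForth (X : A[X]) s i) (backForth X s j) = C e * r) :
    fold s i = fold s j + 1 ∨ fold s j = fold s i + 1 := by
  obtain ⟨ε, hε, hc⟩ := cross_backForth (X : A[X]) s i j
  rw [hc] at h
  have key : ∀ r' : A, r' ≠ 0 → C e * contin (X : A[X])
      ((fold s i - fold s j) + (fold s j - fold s i)) = C r' →
      fold s i = fold s j + 1 ∨ fold s j = fold s i + 1 := by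
    intro r' hr' h
    have := eq_one_of_C_mul_contin he hr' h
    omega
  rcases hε with rfl | rfl <;> rcases hr with rfl | rfl
  · exact key e he (by linear_combination h)
  · exact key (-e) (neg_ne_zero.2 he) (by rw [C_neg]; linear_combination h)
  · exact key (-e) (neg_ne_zero.2 he) (by rw [C_neg]; linear_combination -h)
  · exact key e he (by linear_combination -h)

/-- If `A` has a nontrivial idempotent `e`, two copies of the walk `backForth`, one on each factor
of `A[X]` and shifted by a quarter of a turn, form a chordless cycle: two times at which one of the
walks is at neighbouring positions on different runs are never such for the other walk. -/
theorem exists_mem_Irr_of_isIdempotentElem [Nontrivial A] {e : A}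
    (he : IsIdempotentElem e) (h0 : e ≠ 0) (h1 : e ≠ 1) {s : ℕ} (hs : 2 ≤ s) :
    ∃ l ∈ Irr A[X], l.length = 4 * s := by
  have he' : C e * C e = (C e : A[X]) := by rw [← C_mul, he.eq]
  have h1' : 1 - e ≠ 0 := fun h => h1 (by linear_combination -h)
  set W := backForth (X : A[X]) s with hW
  set q : ℕ → ℕ := fun i => if i + s < 4 * s then i + s else i + s - 4 * s with hq
  have hWl : W (4 * s) = W 0 := backForth_last _ _
  have hq1 : ∀ i < 4 * s, cross (W (q i)) (W (q (i + 1))) = 1 := by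
    intro i hi
    simp only [hq]
    split_ifs with h h' h'
    · rw [show i + 1 + s = i + s + 1 by omega]; exact cross_backForth_succ _ _ h
    · rw [show i + 1 + s - 4 * s = 0 by omega, ← hWl, show 4 * s = i + s + 1 by omega]
      exact cross_backForth_succ _ _ h
    · omega
    · rw [show i + 1 + s - 4 * s = i + s - 4 * s + 1 by omega]
      exact cross_backForth_succ _ _ (by omega)
  have hql : W (q (4 * s)) = W (q 0) := by
    simp only [hq]
    rw [if_neg (by omega), if_pos (by omega), show 4 * s + s - 4 * s = 0 + s by omega]
  have hedge : ∀ i < 4 * s, cross (C e • W i + (1 - C e) • W (q i))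
      (C e • W (i + 1) + (1 - C e) • W (q (i + 1))) = 1 := by
    intro i hi
    rw [cross_idempotent he', hq1 i hi, cross_backForth_succ _ _ hi]; ring
  apply exists_mem_Irr_of_cycle (by omega) fun i => C e • W i + (1 - C e) • W (q i)
  · exact fun i hi => hedge i (by omega)
  · have h := hedge (4 * s - 1) (by omega)
    rwa [show 4 * s - 1 + 1 = 4 * s by omega, hWl, hql] at h
  · intro i j hij hj hne
    rw [← not_or]
    intro h
    rw [cross_idempotent he'] at h
    have key : ∀ r : A[X], r = 1 ∨ r = -1 →
        C e * cross (W i) (W j) + (1 - C e) * cross (W (q i)) (W (q j)) ≠ r := by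
      intro r hr H
      have f1 := fold_eq_of_cross h0 hr (s := s) (i := i) (j := j)
        (by linear_combination C e * H + (cross (W (q i)) (W (q j)) - cross (W i) (W j)) * he')
      have f2 := fold_eq_of_cross h1' hr (s := s) (i := q i) (j := q j)
        (by
          rw [C_sub, C_1]
          linear_combination (1 - C e) * H +
            (cross (W i) (W j) - cross (W (q i)) (W (q j))) * he')
      simp only [fold, hq] at f1 f2
      split_ifs at f1 f2 <;> omega
    exact h.elim (key 1 (Or.inl rfl)) (key (-1) (Or.inr rfl))

end IdempotentPolynomial

/-! ### Finite coefficient rings -/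

theorem exists_isIdempotentElem_pow {R : Type*} [CommMonoid R] [Finite R] (a : R) :
    ∃ k, 0 < k ∧ IsIdempotentElem (a ^ k) := by
  obtain ⟨i, j, hij, h⟩ : ∃ i j : ℕ, i < j ∧ a ^ i = a ^ j := by
    obtain ⟨i, j, hne, h⟩ := Finite.exists_ne_map_eq_of_infinite fun n : ℕ => a ^ n
    rcases hne.lt_or_gt with h' | h'
    · exact ⟨i, j, h', h⟩
    · exact ⟨j, i, h', h.symm⟩
  obtain ⟨p, rfl⟩ := Nat.exists_eq_add_of_lt hij
  have hper : ∀ n q, i ≤ n → a ^ (n + (p + 1) * q) = a ^ n := by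
    intro n q hn
    induction q with
    | zero => simp
    | succ q ih =>
      rw [← ih]
      obtain ⟨m, rfl⟩ := Nat.exists_eq_add_of_le hn
      calc a ^ (i + m + (p + 1) * (q + 1)) = a ^ (i + p + 1) * a ^ (m + (p + 1) * q) := by
            rw [← pow_add]; congr 1; ring
        _ = a ^ (i + m + (p + 1) * q) := by rw [← h, ← pow_add]; congr 1; ring
  refine ⟨(p + 1) * (i + 1), by positivity, ?_⟩
  rw [IsIdempotentElem, ← pow_add]
  exact hper _ _ (by nlinarith)

section Finite

variable {A : Type*} [CommRing A]

theorem ell_polynomial_eq_top [Nontrivial A] [Finite A] {a : A} (h0 : a ≠ 0) (h1 : a ≠ 1)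
    (h2 : a ≠ -1) : ell A[X] = ⊤ := by
  have of_unit : ∀ b : A[X], IsUnit b → b ≠ 1 → b ≠ -1 → ell A[X] = ⊤ := by
    intro b hb hb1 hb2
    obtain ⟨c, hc⟩ := hb.exists_right_inv
    refine ell_eq_top fun N => ?_
    obtain ⟨l, hl, hlen⟩ :=
      exists_mem_Irr_of_unit hc hb1 hb2 (2 * N + 2) ⟨N + 1, by ring⟩ (by omega)
    exact ⟨l, hl, by omega⟩
  obtain ⟨k, hk, he⟩ := exists_isIdempotentElem_pow a
  by_cases hz : a ^ k = 0
  · -- A nonzero nilpotent `a` gives the unit `1 + a X`.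
    have hnil : IsNilpotent (C a * X : A[X]) := ⟨k, by rw [mul_pow, ← C_pow, hz]; simp⟩
    have hcoeff : (1 + C a * X : A[X]).coeff 1 = a := by simp [coeff_one]
    refine of_unit (1 + C a * X) hnil.isUnit_one_add ?_ ?_ <;> intro h <;>
      rw [h] at hcoeff <;> simp [coeff_one] at hcoeff <;> exact h0 hcoeff.symm
  by_cases ho : a ^ k = 1
  · have ha : IsUnit a := IsUnit.of_pow_eq_one ho hk.ne'
    refine of_unit (C a) (ha.map C) ?_ ?_
    · rw [← C_1]; exact fun h => h1 (C_injective h)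
    · rw [← C_1, ← C_neg]; exact fun h => h2 (C_injective h)
  · refine ell_eq_top fun N => ?_
    obtain ⟨l, hl, hlen⟩ := exists_mem_Irr_of_isIdempotentElem he hz ho (s := N + 2) (by omega)
    exact ⟨l, hl, by omega⟩

theorem nonempty_ringEquiv_zmod [Nontrivial A] [Finite A] (h : ∀ a : A, a = 0 ∨ a = 1 ∨ a = -1) :
    Nonempty (A ≃+* ZMod 2) ∨ Nonempty (A ≃+* ZMod 3) := by
  classical
  have := Fintype.ofFinite A
  have huniv : (Finset.univ : Finset A) = {0, 1, -1} := by
    ext a; simpa using h a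
  have hcard : Fintype.card A = ({0, 1, -1} : Finset A).card := by rw [← huniv]; rfl
  by_cases h1 : (1 : A) = -1
  · rw [← h1] at hcard
    simp at hcard
    exact Or.inl ⟨(ZMod.ringEquivOfPrime A Nat.prime_two hcard).symm⟩
  · rw [Finset.card_eq_three.2 ⟨0, 1, -1, by simp, by simp [eq_comm], h1, rfl⟩] at hcard
    exact Or.inr ⟨(ZMod.ringEquivOfPrime A Nat.prime_three hcard).symm⟩

theorem ell_polynomial_lt_top_of_ringEquiv {k : ℕ} (hk : k = 2 ∨ k = 3) (f : A ≃+* ZMod k) :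
    ell A[X] < ⊤ := by
  have : Fact k.Prime := ⟨by rcases hk with rfl | rfl <;> norm_num⟩
  have : IsDomain A := f.toMulEquiv.isDomain _
  rw [ell_polynomial_eq_four]
  · exact ENat.natCast_lt_top 4
  · intro a
    refine (zmod_eq_zero_or_one_or_neg_one hk (f a)).imp (fun h => ?_)
      (Or.imp (fun h => ?_) fun h => ?_) <;> apply f.injective
    · rw [h, map_zero]
    · rw [h, map_one]
    · rw [h, map_neg, map_one]

end Finite

end LambdaQuiddity

theorem theorem3p6 :
    (∀ (A : Type*) [CommRing A] [Nontrivial A] [Finite A],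
      LambdaQuiddity.ell (Polynomial A) < ⊤ ↔
        (Nonempty (A ≃+* ZMod 2) ∨ Nonempty (A ≃+* ZMod 3))) ∧
    (∀ k : ℕ, k = 2 ∨ k = 3 →
      LambdaQuiddity.ell (Polynomial (ZMod k)) = 4 ∧
      LambdaQuiddity.Irr (Polynomial (ZMod k)) =
        {c | c = [1, 1, 1] ∨ c = [-1, -1, -1] ∨
          ∃ P : Polynomial (ZMod k), P ≠ 1 ∧ P ≠ -1 ∧
            (c = [0, P, 0, -P] ∨ c = [P, 0, -P, 0])}) := by
  refine ⟨fun A _ _ _ => ⟨fun h => LambdaQuiddity.nonempty_ringEquiv_zmod fun a => ?_, ?_⟩,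
    fun k hk => ?_⟩
  · by_contra! ha
    exact h.ne (LambdaQuiddity.ell_polynomial_eq_top ha.1 ha.2.1 ha.2.2)
  · rintro (⟨⟨f⟩⟩ | ⟨⟨f⟩⟩)
    · exact LambdaQuiddity.ell_polynomial_lt_top_of_ringEquiv (Or.inl rfl) f
    · exact LambdaQuiddity.ell_polynomial_lt_top_of_ringEquiv (Or.inr rfl) f
  · have : Fact k.Prime := ⟨by rcases hk with rfl | rfl <;> norm_num⟩
    have hA := LambdaQuiddity.zmod_eq_zero_or_one_or_neg_one hk
    exact ⟨LambdaQuiddity.ell_polynomial_eq_four hA, LambdaQuiddity.Irr_polynomial_eq hA⟩
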